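/- **Proposition 4 (Dominating shift-invariant kernels).** A *kernel* on $\mathbb{R}^d$ is a function $\mathbf{k}:\mathbb{R}^d\times\mathbb{R}^d\to\mathbb{R}$ such that every matrix $(\mathbf{k}(z_i,z_j))_{i,j=1}^{l}$, $z_1,\dots,z_l\in\mathbb{R}^d$, is symmetric and positive semidefinite. A kernel $\tilde{\mathbf{k}}_{\mathrm{rt}}$ is a *square-root dominating kernel* for a kernel $\mathbf{k}$ if the integrals $\tilde{\mathbf{k}}(x,y)=\int_{\mathbb{R}^d}\tilde{\mathbf{k}}_{\mathrm{rt}}(x,z)\,\tilde{\mathbf{k}}_{\mathrm{rt}}(y,z)\,dz$ converge absolutely for all $x,y\in\mathbb{R}^d$ and either of the following equivalent conditions holds: (a) the reproducing kernel Hilbert space of $\mathbf{k}$ is contained, as a set of functions, in that of $\tilde{\mathbf{k}}$; (b) $\tilde{\mathbf{k}}-c\,\mathbf{k}$ is positive definite (that is, a kernel in the above sense) for some $c>0$. For a Schwartz function $\gamma$ on $\mathbb{R}^d$ let $\hat\gamma(x)=(2\pi)^{-d/2}\int\gamma(\omega)e^{-i\langle x,\omega\rangle}\,d\omega$. A measurable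 function $\widehat{\Phi}$, locally square integrable on $\mathbb{R}^d\setminus\{0\}$, is a *generalized Fourier transform of order $0$* of a continuous function $\Phi$ on $\mathbb{R}^d$ of at most polynomial growth if, for all complex-valued Schwartz functions $\gamma$, the function $\widehat{\Phi}\gamma$ is integrable and $\int\Phi(x)\hat\gamma(x)\,dx=\int\widehat{\Phi}(\omega)\gamma(\omega)\,d\omega$. Let $\mathbf{k}(x,y)=\kappa(x-y)$ and $\tilde{\mathbf{k}}_{\mathrm{rt}}(x,y)=\tilde\kappa_{\mathrm{rt}}(x-y)$ be real continuous kernels on $\mathbb{R}^d$ such that $\kappa$ and $\tilde\kappa_{\mathrm{rt}}$ have real-valued generalized Fourier transforms $\widehat\kappa$ and $\widehat\kappa_{\mathrm{rt}}$ of order $0$, with $\widehat\kappa_{\mathrm{rt}}\in L^2(\mathbb{R}^d)$. Then $\tilde{\mathbf{k}}_{\mathrm{rt}}$ is a square-root dominating kernel for $\mathbf{k}$ (in the form (a), and equally in the form (b)) if and only if $$\operatorname*{ess\,sup}_{\omega\in\mathbb{R}^d:\ \widehat\kappa(\omega)>0}\ \frac{\widehat\kappa(\omega)}{\widehat\kappa_{\mathrm{rt}}(\omega)^2}<\infty,$$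 where a quotient with positive numerator and zero denominator is $+\infty$, and the condition counts as satisfied if $\{\widehat\kappa>0\}$ is a null set. -/

import Mathlib

open MeasureTheory Filter Topology
open scoped ENNReal SchwartzMap

/-- A (reproducing) kernel on `X`: a real function of two variables all of whose kernel matrices
`(k (z i) (z j))` are symmetric and positive semidefinite. -/
def IsKernel {X : Type*} (k : X → X → ℝ) : Prop :=
  ∀ (l : ℕ) (z : Fin l → X), (Matrix.of fun i j => k (z i) (z j)).PosSemidef

/-- The reproducing kernel Hilbert space of the kernel `k`, as a set of functions:
the members of the complete Hilbert space of functions whose reproducing kernel is `k`. -/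
def rkhsFunctions {X : Type} (k : X → X → ℝ) : Set (X → ℝ) :=
  {f | ∃ (H : Type) (_ : NormedAddCommGroup H) (_ : InnerProductSpace ℝ H) (_ : CompleteSpace H)
      (_ : RKHS ℝ H X ℝ), (∀ x y : X, RKHS.kernel H x y 1 = k x y) ∧ ∃ h : H, ⇑h = f}

/-- The kernel `(x, y) ↦ ∫ g x z * g y z dz` obtained from a candidate square root `g`. -/
noncomputable def sqrtDomKernel {d : ℕ}
    (g : EuclideanSpace ℝ (Fin d) → EuclideanSpace ℝ (Fin d) → ℝ) :
    EuclideanSpace ℝ (Fin d) → EuclideanSpace ℝ (Fin d) → ℝ :=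
  fun x y => ∫ z, g x z * g y z

/-- Square-root domination, containment form: the integrals `∫ g x z * g y z dz` converge and the
RKHS of `k` is contained in the RKHS of the kernel they define. -/
def IsSqrtDominatingRKHS {d : ℕ}
    (g k : EuclideanSpace ℝ (Fin d) → EuclideanSpace ℝ (Fin d) → ℝ) : Prop :=
  (∀ x y, Integrable (fun z => g x z * g y z)) ∧
    rkhsFunctions k ⊆ rkhsFunctions (sqrtDomKernel g)

/-- Square-root domination, positive definite order form: the integrals `∫ g x z * g y z dz`
converge and the kernel they define minus `c * k` is positive definite for some `c > 0`. -/
def IsSqrtDominatingPD {d : ℕ}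
    (g k : EuclideanSpace ℝ (Fin d) → EuclideanSpace ℝ (Fin d) → ℝ) : Prop :=
  (∀ x y, Integrable (fun z => g x z * g y z)) ∧
    ∃ c : ℝ, 0 < c ∧ IsKernel (fun x y => sqrtDomKernel g x y - c * k x y)

/-- The Fourier transform in the unitary angular frequency convention,
`(2π)^(-d/2) ∫ f(x) exp(-i⟨x, ω⟩) dx`. -/
noncomputable def unitaryFourier {d : ℕ} (f : EuclideanSpace ℝ (Fin d) → ℂ)
    (ω : EuclideanSpace ℝ (Fin d)) : ℂ :=
  (((2 * Real.pi) ^ (-(d : ℝ) / 2) : ℝ) : ℂ) *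
    ∫ x, f x * Complex.exp (-Complex.I * ((inner ℝ x ω : ℝ) : ℂ))

/-- `Ψ` is a generalized Fourier transform of order `m` of the function `Φ`: `Φ` is continuous and
slowly increasing, `Ψ` is measurable and locally square integrable away from the origin, and
`∫ Φ γ̂ = ∫ Ψ γ` for all Schwartz functions `γ` with `γ(ω) = O(‖ω‖^(2m))` as `ω → 0`,
the integral on the right being convergent. -/
structure IsGeneralizedFourierTransform {d : ℕ} (m : ℕ)
    (Φ Ψ : EuclideanSpace ℝ (Fin d) → ℂ) : Prop where
  continuous : Continuous Φ
  slowly_increasing : ∃ n : ℕ,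
    Φ =O[Bornology.cobounded (EuclideanSpace ℝ (Fin d))] fun x => ‖x‖ ^ n
  aestronglyMeasurable : AEStronglyMeasurable Ψ volume
  locally_sq_integrable : LocallyIntegrableOn (fun ω => ‖Ψ ω‖ ^ 2) {0}ᶜ volume
  integrable_mul : ∀ γ : 𝓢(EuclideanSpace ℝ (Fin d), ℂ),
    (γ =O[𝓝 0] fun ω => ‖ω‖ ^ (2 * m)) → Integrable (fun ω => Ψ ω * γ ω)
  integral_eq : ∀ γ : 𝓢(EuclideanSpace ℝ (Fin d), ℂ),
    (γ =O[𝓝 0] fun ω => ‖ω‖ ^ (2 * m)) →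
      ∫ x, Φ x * unitaryFourier γ x = ∫ ω, Ψ ω * γ ω

/-! Both domination conditions reduce to a pointwise inequality between Fourier transforms. By
Bochner's theorem (`bochner`) the generalized transforms of `κ` and `κrt` are nonnegative and
integrable, and each function is the Fourier integral of its transform. Since the transform of `κrt`
is also in `L²`, Parseval's identity shows that the dominating kernel is shift-invariant, with
density the square of that of `κrt`. Hence `kt - c k`, where `kt` is the dominating kernel, is the
transform of an integrable density `ψrt² - c ψ`, and it is a kernel exactly when this density is
nonnegative almost everywhere (`isKernel_integral_sub_mul_iff`). Existence of such a `c > 0` is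
finiteness of the essential supremum (`essSup_div_lt_top_iff`).

The containment form follows from Aronszajn's theorem (`rkhsFunctions_subset_iff`): inclusion of
function sets already forces a norm inequality, by uniform boundedness, and Riesz representation
gives the converse. -/

/-! ### Kernels, quadratic forms and feature maps. -/

lemma isKernel_iff {X : Type*} {k : X → X → ℝ} :
    IsKernel k ↔ (∀ x y, k x y = k y x) ∧
      ∀ a : X →₀ ℝ, 0 ≤ a.sum fun x s => a.sum fun y t => s * t * k x y := by
  constructor
  · intro h
    refine ⟨fun x y => ?_, fun a => ?_⟩
    · have := (h 2 ![x, y]).1.apply 0 1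
      simpa using this.symm
    · obtain ⟨n, ⟨e⟩⟩ := Finite.exists_equiv_fin a.support
      have := (h n (fun i => (e.symm i : X))).dotProduct_mulVec_nonneg (fun i => a (e.symm i))
      simp only [dotProduct, Matrix.mulVec, Matrix.of_apply, Pi.star_apply, star_trivial,
        Finset.mul_sum] at this
      have h2 : ∀ g : X → ℝ, ∑ i : Fin n, g (e.symm i) = ∑ x ∈ a.support, g x := fun g => by
        rw [Equiv.sum_comp e.symm (fun x : a.support => g x), Finset.sum_coe_sort a.support g]
      simp only [Finsupp.sum]
      rw [← h2]
      refine this.trans_eq (Finset.sum_congr rfl fun i _ => ?_)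
      rw [← h2]
      exact Finset.sum_congr rfl fun j _ => by ring
  · rintro ⟨hs, h⟩ l z
    refine Matrix.PosSemidef.of_dotProduct_mulVec_nonneg ?_ fun v => ?_
    · ext i j
      simp [hs (z j) (z i)]
    · have hadd : ∀ (a : X →₀ ℝ) (x : X) (s t : ℝ),
          (a.sum fun y u => (s + t) * u * k x y) =
            (a.sum fun y u => s * u * k x y) + a.sum fun y u => t * u * k x y := by
        intro a x s t
        rw [← Finsupp.sum_add]
        exact Finsupp.sum_congr fun y _ => by ring
      -- The points `z i` may coincide; summing the `single`s merges the coefficients of repeated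
      -- points.
      have := h (∑ i, Finsupp.single (z i) (v i))
      rw [← Finsupp.sum_finsetSum_index (by simp) (fun x s t => hadd _ x s t)] at this
      refine this.trans_eq ?_
      simp only [dotProduct, Matrix.mulVec, Matrix.of_apply, Pi.star_apply, star_trivial,
        Finset.mul_sum]
      refine Finset.sum_congr rfl fun i _ => ?_
      rw [Finsupp.sum_single_index (by simp), ← Finsupp.sum_finsetSum_index (by simp)
        (by intros; ring)]
      refine Finset.sum_congr rfl fun j _ => ?_
      rw [Finsupp.sum_single_index (by simp)]; ring

/-- Moore–Aronszajn: the scalar kernel is read as an operator-valued one through multiples of the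
identity of `ℝ`. -/
lemma IsKernel.exists_rkhs {X : Type} {k : X → X → ℝ} (hk : IsKernel k) :
    ∃ (H : Type) (_ : NormedAddCommGroup H) (_ : InnerProductSpace ℝ H) (_ : CompleteSpace H)
      (_ : RKHS ℝ H X ℝ), ∀ x y : X, RKHS.kernel H x y 1 = k x y := by
  obtain ⟨hs, hp⟩ := isKernel_iff.1 hk
  let K : Matrix X X (ℝ →L[ℝ] ℝ) := .of fun x y => k x y • ContinuousLinearMap.id ℝ ℝ
  have hK : K.PosSemidef := by
    have htfae := (RKHS.posSemidef_tfae (K := K)).out 0 2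
    refine htfae.2 ⟨?_, fun v => ?_⟩
    · ext x y
      have h1 : star (ContinuousLinearMap.id ℝ ℝ) = ContinuousLinearMap.id ℝ ℝ := star_one _
      simp [K, Matrix.conjTranspose_apply, hs x y, h1]
    · refine (hp v).trans_eq ?_
      simp only [Finsupp.sum, K]
      simp
      refine Finset.sum_congr rfl fun x _ => Finset.sum_congr rfl fun y _ => ?_
      rw [hs y x]; ring
  have : Fact K.PosSemidef := ⟨hK⟩
  refine ⟨RKHS.OfKernel K, inferInstance, inferInstance, inferInstance, inferInstance, ?_⟩
  intro x y
  rw [RKHS.OfKernel.kernel_ofKernel]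
  simp [K]

section
variable {X H : Type*} [NormedAddCommGroup H] [InnerProductSpace ℝ H] {φ : X → H} {k : X → X → ℝ}

lemma finsupp_sum_sum_eq_norm_sq (hφ : ∀ x y, inner ℝ (φ x) (φ y) = k x y) (a : X →₀ ℝ) :
    (a.sum fun x s => a.sum fun y t => s * t * k x y) =
      ‖Finsupp.linearCombination ℝ φ a‖ ^ 2 := by
  rw [← real_inner_self_eq_norm_sq, Finsupp.linearCombination_apply, Finsupp.sum_inner]
  refine Finsupp.sum_congr fun x _ => ?_
  rw [Finsupp.inner_sum]
  refine Finsupp.sum_congr fun y _ => ?_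
  rw [inner_smul_left, inner_smul_right, hφ]
  simp; ring

/-- `kt - c k` is a kernel if and only if feature maps for `k` and `kt` satisfy
`c ‖∑ aᵢ φ(xᵢ)‖² ≤ ‖∑ aᵢ φt(xᵢ)‖²`. -/
lemma isKernel_sub_mul_iff {Ht : Type*} [NormedAddCommGroup Ht] [InnerProductSpace ℝ Ht]
    {φt : X → Ht} {kt : X → X → ℝ} (hφ : ∀ x y, inner ℝ (φ x) (φ y) = k x y)
    (hφt : ∀ x y, inner ℝ (φt x) (φt y) = kt x y) (c : ℝ) :
    IsKernel (fun x y => kt x y - c * k x y) ↔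
      ∀ a, c * ‖Finsupp.linearCombination ℝ φ a‖ ^ 2 ≤ ‖Finsupp.linearCombination ℝ φt a‖ ^ 2 := by
  have key : ∀ a : X →₀ ℝ, (a.sum fun x s => a.sum fun y t => s * t * (kt x y - c * k x y)) =
      ‖Finsupp.linearCombination ℝ φt a‖ ^ 2 - c * ‖Finsupp.linearCombination ℝ φ a‖ ^ 2 := by
    intro a
    rw [← finsupp_sum_sum_eq_norm_sq hφ, ← finsupp_sum_sum_eq_norm_sq hφt]
    simp only [Finsupp.sum, Finset.mul_sum, ← Finset.sum_sub_distrib]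
    exact Finset.sum_congr rfl fun _ _ => Finset.sum_congr rfl fun _ _ => by ring
  rw [isKernel_iff]
  simp only [key, sub_nonneg]
  refine and_iff_right fun x y => ?_
  rw [← hφ, ← hφt, ← hφ y x, ← hφt y x, real_inner_comm, real_inner_comm (φ y)]
end

/-! ### Aronszajn's inclusion theorem. -/

/-- Riesz representation of a functional dominated by the seminorm `a ↦ ‖A a‖`. -/
lemma exists_inner_eq_of_le_norm {M H : Type*} [AddCommGroup M] [Module ℝ M]
    [NormedAddCommGroup H] [InnerProductSpace ℝ H] [CompleteSpace H] (A : M →ₗ[ℝ] H)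
    (l : M →ₗ[ℝ] ℝ) {C : ℝ} (hC : ∀ a, |l a| ≤ C * ‖A a‖) :
    ∃ w : H, ∀ a, inner ℝ w (A a) = l a := by
  obtain ⟨r, hr⟩ := A.rangeRestrict.exists_rightInverse_of_surjective A.range_rangeRestrict
  have hAr : ∀ y, A (r y) = y := fun y => by
    have := congrArg Subtype.val (LinearMap.congr_fun hr y)
    simpa using this
  let g : LinearMap.range A →L[ℝ] ℝ := (l ∘ₗ r).mkContinuous C fun y => by
    have := hC (r y)
    rw [hAr] at this
    simpa using this
  obtain ⟨G, hG, -⟩ := exists_extension_norm_eq (LinearMap.range A) g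
  refine ⟨(InnerProductSpace.toDual ℝ H).symm G, fun a => ?_⟩
  rw [InnerProductSpace.toDual_symm_apply]
  have h1 : G (A a) = l (r (A.rangeRestrict a)) := hG (A.rangeRestrict a)
  -- The bound makes `l` vanish on the kernel of `A`, so the choice of preimage `r` does not matter.
  have h2 := hC (r (A.rangeRestrict a) - a)
  rw [map_sub, map_sub, hAr] at h2
  have h3 : ((A.rangeRestrict a : LinearMap.range A) : H) = A a := rfl
  rw [h3, sub_self, norm_zero, mul_zero] at h2
  rw [h1]
  exact sub_eq_zero.1 (abs_nonpos_iff.1 h2)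

section
variable {X H : Type*} [NormedAddCommGroup H] [InnerProductSpace ℝ H] [CompleteSpace H]
  [RKHS ℝ H X ℝ] {k : X → X → ℝ}

lemma inner_kerFun_kerFun (hk : ∀ x y : X, RKHS.kernel H x y 1 = k x y) (x y : X) :
    inner ℝ (RKHS.kerFun H x (1 : ℝ)) (RKHS.kerFun H y (1 : ℝ)) = k x y := by
  rw [real_inner_comm, ← RKHS.kernel_inner]
  have : RKHS.kernel H x y 1 = k x y := hk x y
  rw [this]; simp

lemma inner_linearCombination_kerFun (a : X →₀ ℝ) (h : H) :
    inner ℝ (Finsupp.linearCombination ℝ (fun x => RKHS.kerFun H x (1 : ℝ)) a) h =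
      Finsupp.linearCombination ℝ (⇑h) a := by
  rw [Finsupp.linearCombination_apply, Finsupp.linearCombination_apply, Finsupp.sum_inner]
  exact Finsupp.sum_congr fun x _ => by simp [inner_smul_left]

end

section
variable {X : Type} {H Ht : Type} [NormedAddCommGroup H] [InnerProductSpace ℝ H] [CompleteSpace H]
  [RKHS ℝ H X ℝ] [NormedAddCommGroup Ht] [InnerProductSpace ℝ Ht] [CompleteSpace Ht]
  [RKHS ℝ Ht X ℝ] {k kt : X → X → ℝ}

lemma mem_rkhsFunctions (hk : ∀ x y : X, RKHS.kernel H x y 1 = k x y) (v : H) :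
    ⇑v ∈ rkhsFunctions k :=
  ⟨H, inferInstance, inferInstance, inferInstance, inferInstance, hk, v, rfl⟩

/-- The functional `a ↦ ∑ a x * v x` is an inner product with `v`, hence bounded by the norm in `H`
and so, up to `1 / √c`, by the norm in `Ht`. Its Riesz representative in `Ht` has the same point
values as `v`. -/
lemma coe_mem_rkhsFunctions_of_isKernel_sub (hH : ∀ x y : X, RKHS.kernel H x y 1 = k x y)
    (hHt : ∀ x y : X, RKHS.kernel Ht x y 1 = kt x y) {c : ℝ} (hc : 0 < c)
    (h : IsKernel fun x y => kt x y - c * k x y) (v : H) : ⇑v ∈ rkhsFunctions kt := by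
  have hle := (isKernel_sub_mul_iff (inner_kerFun_kerFun hH) (inner_kerFun_kerFun hHt) c).1 h
  obtain ⟨w, hw⟩ := exists_inner_eq_of_le_norm
    (Finsupp.linearCombination ℝ fun x => RKHS.kerFun Ht x (1 : ℝ))
    (Finsupp.linearCombination ℝ (⇑v)) (C := ‖v‖ / √c) fun a => by
      rw [← inner_linearCombination_kerFun]
      refine (abs_real_inner_le_norm _ _).trans ?_
      rw [mul_comm, div_mul_eq_mul_div, mul_div_assoc]
      refine mul_le_mul_of_nonneg_left ?_ (norm_nonneg _)
      rw [le_div_iff₀ (Real.sqrt_pos.2 hc)]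
      refine abs_le_of_sq_le_sq' ?_ (norm_nonneg _) |>.2
      rw [mul_pow, Real.sq_sqrt hc.le, mul_comm]
      exact hle a
  have hwv : ⇑w = ⇑v := funext fun x => by
    have := hw (Finsupp.single x 1)
    rw [real_inner_comm, inner_linearCombination_kerFun] at this
    simpa using this
  rw [← hwv]
  exact mem_rkhsFunctions hHt w

/-- The space witnessing `hf` need not be `H`, but norms of combinations of kernel functions depend
only on `k`. -/
lemma exists_abs_linearCombination_le {f : X → ℝ} (hf : f ∈ rkhsFunctions k)
    (hH : ∀ x y : X, RKHS.kernel H x y 1 = k x y) :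
    ∃ C, ∀ a, |Finsupp.linearCombination ℝ f a| ≤
      C * ‖Finsupp.linearCombination ℝ (fun x : X => RKHS.kerFun H x (1 : ℝ)) a‖ := by
  obtain ⟨H', _, _, _, _, hH', v', rfl⟩ := hf
  refine ⟨‖v'‖, fun a => ?_⟩
  rw [← inner_linearCombination_kerFun]
  refine (abs_real_inner_le_norm _ _).trans ?_
  rw [mul_comm]
  refine mul_le_mul_of_nonneg_left (le_of_eq ?_) (norm_nonneg _)
  rw [← sq_eq_sq₀ (norm_nonneg _) (norm_nonneg _),
    ← finsupp_sum_sum_eq_norm_sq (inner_kerFun_kerFun hH'),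
    ← finsupp_sum_sum_eq_norm_sq (inner_kerFun_kerFun hH)]

/-- Uniform boundedness for the functionals `⟪B a, ·⟫` on `H` with `‖A a‖ ≤ 1`: they are bounded at
each `v` because `v`, as a function, also lies in the RKHS of `kt`. -/
lemma exists_norm_linearCombination_kerFun_le (hH : ∀ x y : X, RKHS.kernel H x y 1 = k x y)
    (hHt : ∀ x y : X, RKHS.kernel Ht x y 1 = kt x y) (h : rkhsFunctions k ⊆ rkhsFunctions kt) :
    ∃ C, 0 < C ∧ ∀ a, ‖Finsupp.linearCombination ℝ (fun x : X => RKHS.kerFun H x (1 : ℝ)) a‖ ≤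
      C * ‖Finsupp.linearCombination ℝ (fun x : X => RKHS.kerFun Ht x (1 : ℝ)) a‖ := by
  set A := Finsupp.linearCombination ℝ fun x : X => RKHS.kerFun Ht x (1 : ℝ) with hA
  set B := Finsupp.linearCombination ℝ fun x : X => RKHS.kerFun H x (1 : ℝ) with hB
  obtain ⟨C, hC⟩ := banach_steinhaus
    (g := fun a : {a : X →₀ ℝ // ‖A a‖ ≤ 1} => innerSL ℝ (B a.1)) fun v => by
      obtain ⟨D, hD⟩ := exists_abs_linearCombination_le (h (mem_rkhsFunctions hH v)) hHt
      refine ⟨|D|, fun ⟨a, ha⟩ => ?_⟩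
      rw [innerSL_apply_apply, hB, inner_linearCombination_kerFun, Real.norm_eq_abs]
      refine (hD a).trans ?_
      rw [← hA]
      nlinarith [le_abs_self D, abs_nonneg D, norm_nonneg (A a)]
  have hC0 : 0 ≤ C := (norm_nonneg _).trans (hC ⟨0, by simp⟩)
  refine ⟨C + 1, by positivity, fun a => ?_⟩
  -- The `ε` permits normalizing `a` even when `A a = 0`.
  have h1 : ∀ ε > 0, ‖B a‖ ≤ C * (‖A a‖ + ε) := by
    intro ε hε
    have hp : 0 < ‖A a‖ + ε := by positivity
    have := hC ⟨(‖A a‖ + ε)⁻¹ • a, by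
      rw [map_smul, norm_smul, norm_inv, Real.norm_of_nonneg hp.le, inv_mul_le_one₀ hp]
      linarith⟩
    simp only [innerSL_apply_norm] at this
    rw [map_smul, norm_smul, norm_inv, Real.norm_of_nonneg hp.le, inv_mul_le_iff₀ hp] at this
    linarith
  have h2 : ‖B a‖ ≤ C * ‖A a‖ := by
    have ht : Tendsto (fun ε : ℝ => C * (‖A a‖ + ε)) (𝓝[>] 0) (𝓝 (C * (‖A a‖ + 0))) :=
      (Continuous.tendsto (by fun_prop) 0).mono_left nhdsWithin_le_nhds
    rw [add_zero] at ht
    exact ge_of_tendsto ht (eventually_mem_nhdsWithin.mono fun ε hε => h1 ε hε)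
  nlinarith [norm_nonneg (A a)]

end

/-- Aronszajn's inclusion theorem. -/
theorem rkhsFunctions_subset_iff {X : Type} {k kt : X → X → ℝ} (hk : IsKernel k)
    (hkt : IsKernel kt) :
    rkhsFunctions k ⊆ rkhsFunctions kt ↔
      ∃ c : ℝ, 0 < c ∧ IsKernel fun x y => kt x y - c * k x y := by
  obtain ⟨Ht, _, _, _, _, hHt⟩ := hkt.exists_rkhs
  constructor
  · intro h
    obtain ⟨H, _, _, _, _, hH⟩ := hk.exists_rkhs
    obtain ⟨C, hC, hle⟩ := exists_norm_linearCombination_kerFun_le hH hHt h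
    refine ⟨(C ^ 2)⁻¹, by positivity, (isKernel_sub_mul_iff (inner_kerFun_kerFun hH)
      (inner_kerFun_kerFun hHt) _).2 fun a => ?_⟩
    rw [inv_mul_le_iff₀ (by positivity), ← mul_pow]
    exact pow_le_pow_left₀ (norm_nonneg _) (hle a) 2
  · rintro ⟨c, hc, h⟩ f ⟨H, _, _, _, _, hH, v, rfl⟩
    exact coe_mem_rkhsFunctions_of_isKernel_sub hH hHt hc h v

lemma IsKernel.exists_inner_eq {X : Type} {k : X → X → ℝ} (hk : IsKernel k) :
    ∃ (H : Type) (_ : NormedAddCommGroup H) (_ : InnerProductSpace ℝ H) (_ : CompleteSpace H)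
      (φ : X → H), ∀ x y, inner ℝ (φ x) (φ y) = k x y := by
  obtain ⟨H, i1, i2, i3, _, hH⟩ := hk.exists_rkhs
  exact ⟨H, i1, i2, i3, _, inner_kerFun_kerFun hH⟩

/-! ### Bochner's theorem for densities. -/

section
open scoped FourierTransform
variable {E : Type} [NormedAddCommGroup E]  {Φ : E → ℝ}

lemma abs_le_of_isKernel_sub (hΦ : IsKernel fun x y => Φ (x - y)) (x : E) : |Φ x| ≤ Φ 0 := by
  obtain ⟨H, _, _, _, φ, hφ⟩ := hΦ.exists_inner_eq
  have hn : ∀ x, ‖φ x‖ ^ 2 = Φ 0 := fun x => by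
    rw [← real_inner_self_eq_norm_sq (φ x), hφ, sub_self]
  have h1 : Φ x = inner ℝ (φ x) (φ 0) := by simp [hφ]
  have h2 : ‖φ x‖ = ‖φ 0‖ := by
    rw [← sq_eq_sq₀ (norm_nonneg _) (norm_nonneg _), hn, hn]
  rw [h1, ← hn 0, sq]
  exact (abs_real_inner_le_norm _ _).trans_eq (by rw [h2])

lemma even_of_isKernel_sub (hΦ : IsKernel fun x y => Φ (x - y)) (x : E) : Φ (-x) = Φ x := by
  simpa using (isKernel_iff.1 hΦ).1 0 x

variable [MeasurableSpace E] [BorelSpace E] [SecondCountableTopology E] {μ : Measure E}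

lemma integrable_mul_mul_isKernel_sub {𝕜 : Type*} [RCLike 𝕜] (hc : Continuous Φ)
    (hΦ : IsKernel fun x y => Φ (x - y)) {u v : E → 𝕜} (hu : Integrable u μ) (hv : Integrable v μ) :
    Integrable (fun p : E × E => u p.1 * v p.2 * (Φ (p.1 - p.2) : 𝕜)) (μ.prod μ) := by
  refine (hu.mul_prod hv).mul_bdd (c := Φ 0) (Continuous.aestronglyMeasurable (by fun_prop))
    (Eventually.of_forall fun p => ?_)
  simpa using abs_le_of_isKernel_sub hΦ (p.1 - p.2)

/-- The double integral is the squared norm of the vector `∫ u x • φ x`. The feature map `φ` is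
continuous because `‖φ y - φ x‖² = 2 Φ 0 - 2 Φ (y - x)`. -/
lemma integral_mul_mul_isKernel_sub_nonneg [SFinite μ] (hc : Continuous Φ)
    (hΦ : IsKernel fun x y => Φ (x - y)) {u : E → ℝ} (hu : Integrable u μ) :
    0 ≤ ∫ p : E × E, u p.1 * u p.2 * Φ (p.1 - p.2) ∂(μ.prod μ) := by
  have hint : Integrable (fun p : E × E => u p.1 * u p.2 * Φ (p.1 - p.2)) (μ.prod μ) :=
    integrable_mul_mul_isKernel_sub hc hΦ hu hu
  obtain ⟨H, _, _, _, φ, hφ⟩ := hΦ.exists_inner_eq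
  have hφc : Continuous φ := by
    rw [continuous_iff_continuousAt]
    intro x
    have h1 : ∀ y, ‖φ y - φ x‖ = √(2 * Φ 0 - 2 * Φ (y - x)) := fun y => by
      rw [← Real.sqrt_sq (norm_nonneg _), @norm_sub_sq_real, ← real_inner_self_eq_norm_sq,
        ← real_inner_self_eq_norm_sq, hφ, hφ, hφ, sub_self, sub_self]
      congr 1; ring
    rw [ContinuousAt, tendsto_iff_norm_sub_tendsto_zero]
    simp only [h1]
    have : Continuous fun y => √(2 * Φ 0 - 2 * Φ (y - x)) := by fun_prop
    simpa using this.tendsto x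
  have hn : ∀ x, ‖φ x‖ ≤ √(Φ 0) := fun x => by
    rw [← Real.sqrt_sq (norm_nonneg (φ x)), ← real_inner_self_eq_norm_sq, hφ, sub_self]
  have hi : Integrable (fun x => u x • φ x) μ :=
    hu.smul_bdd (√(Φ 0)) hφc.aestronglyMeasurable (Eventually.of_forall hn)
  have key : ∫ p : E × E, u p.1 * u p.2 * Φ (p.1 - p.2) ∂(μ.prod μ) =
      inner ℝ (∫ x, u x • φ x ∂μ) (∫ x, u x • φ x ∂μ) := by
    rw [integral_prod _ hint, real_inner_comm, ← integral_inner hi]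
    refine integral_congr_ae (Eventually.of_forall fun x => ?_)
    simp only
    rw [real_inner_comm, ← integral_inner hi]
    refine integral_congr_ae (Eventually.of_forall fun y => ?_)
    simp only [inner_smul_left, inner_smul_right, hφ]
    simp only [conj_trivial]
    ring
  rw [key]
  exact real_inner_self_nonneg

end

section
open scoped FourierTransform
variable {E : Type} [NormedAddCommGroup E] [InnerProductSpace ℝ E] [FiniteDimensional ℝ E]
  [MeasurableSpace E] [BorelSpace E] {Φ : E → ℝ}

lemma integral_mul_conj_isKernel_sub_nonneg (hc : Continuous Φ)
    (hΦ : IsKernel fun x y => Φ (x - y)) {f : E → ℂ} (hf : Integrable f) :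
    0 ≤ (∫ p : E × E, f p.1 * (starRingEnd ℂ) (f p.2) * (Φ (p.1 - p.2) : ℂ)).re := by
  have hint : Integrable (fun p : E × E =>
      f p.1 * (starRingEnd ℂ) (f p.2) * (Φ (p.1 - p.2) : ℂ)) :=
    integrable_mul_mul_isKernel_sub (𝕜 := ℂ) hc hΦ hf (v := fun y => (starRingEnd ℂ) (f y))
      (Complex.conjCLE.toContinuousLinearMap.integrable_comp hf)
  have hre : Integrable (fun p : E × E => (f p.1).re * (f p.2).re * Φ (p.1 - p.2)) :=
    integrable_mul_mul_isKernel_sub (𝕜 := ℝ) hc hΦ hf.re hf.re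
  have him : Integrable (fun p : E × E => (f p.1).im * (f p.2).im * Φ (p.1 - p.2)) :=
    integrable_mul_mul_isKernel_sub (𝕜 := ℝ) hc hΦ hf.im hf.im
  have h := integral_re hint
  simp only [RCLike.re_to_complex] at h
  rw [← h]
  refine (add_nonneg (integral_mul_mul_isKernel_sub_nonneg hc hΦ hf.re)
    (integral_mul_mul_isKernel_sub_nonneg hc hΦ hf.im)).trans_eq ?_
  refine (integral_add hre him).symm.trans ?_
  refine integral_congr_ae (Eventually.of_forall fun p => ?_)
  simp
  ring

/-- Hermitian symmetry replaces `f (x - t)` by the conjugate of `f (t - x)`; Fubini and `y = t - x`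
then give the quadratic form of `Φ`. -/
lemma re_integral_convolution_nonneg (hc : Continuous Φ) (hΦ : IsKernel fun x y => Φ (x - y))
    (f : 𝓢(E, ℂ)) (hf : ∀ x, f (-x) = (starRingEnd ℂ) (f x)) :
    0 ≤ (∫ x, (Φ x : ℂ) * SchwartzMap.convolution (.mul ℂ ℂ) f f x).re := by
  have hint : Integrable (fun p : E × E => (Φ p.1 : ℂ) * (f p.2 * f (p.1 - p.2))) := by
    refine (f.integrable.convolution_integrand (.mul ℂ ℂ) f.integrable).bdd_mul (c := Φ 0)
      (Continuous.aestronglyMeasurable (by fun_prop)) (Eventually.of_forall fun p => ?_)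
    simpa using abs_le_of_isKernel_sub hΦ p.1
  have hint' : Integrable (fun p : E × E =>
      f p.1 * (starRingEnd ℂ) (f p.2) * (Φ (p.1 - p.2) : ℂ)) :=
    integrable_mul_mul_isKernel_sub (𝕜 := ℂ) hc hΦ f.integrable
    (v := fun y => (starRingEnd ℂ) (f y)) (Complex.conjCLE.toContinuousLinearMap.integrable_comp f.integrable)
  have key : ∫ x, (Φ x : ℂ) * SchwartzMap.convolution (.mul ℂ ℂ) f f x =
      ∫ p : E × E, f p.1 * (starRingEnd ℂ) (f p.2) * (Φ (p.1 - p.2) : ℂ) := by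
    calc _ = ∫ x, ∫ t, (Φ x : ℂ) * (f t * f (x - t)) := by
          refine integral_congr_ae (Eventually.of_forall fun x => ?_)
          simp only [SchwartzMap.convolution_apply, MeasureTheory.convolution,
            ContinuousLinearMap.mul_apply']
          rw [integral_const_mul]
      _ = ∫ t, ∫ x, (Φ x : ℂ) * (f t * f (x - t)) := integral_integral_swap hint
      _ = ∫ t, ∫ y, f t * (starRingEnd ℂ) (f y) * (Φ (t - y) : ℂ) := by
          refine integral_congr_ae (Eventually.of_forall fun t => ?_)
          simp only
          rw [← integral_sub_left_eq_self _ volume t]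
          refine integral_congr_ae (Eventually.of_forall fun y => ?_)
          simp only
          rw [← hf]
          rw [sub_sub_cancel_left]; ring
      _ = _ := (integral_prod _ hint').symm
  rw [key]
  exact integral_mul_conj_isKernel_sub_nonneg hc hΦ f.integrable

/-- A distributional Fourier transform of a positive definite function is nonnegative
when tested against squares. -/
lemma integral_mul_sq_nonneg (hc : Continuous Φ) (hΦ : IsKernel fun x y => Φ (x - y))
    {ψ : E → ℝ} (heq : ∀ γ : 𝓢(E, ℂ), ∫ x, (Φ x : ℂ) * γ x = ∫ w, (ψ w : ℂ) * 𝓕 γ w)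
    {χ : E → ℝ} (hχ : ContDiff ℝ (⊤ : ℕ∞) χ) (hχs : HasCompactSupport χ) :
    0 ≤ ∫ w, ψ w * χ w ^ 2 := by
  have hχs' : HasCompactSupport fun x => (χ x : ℂ) := hχs.comp_left (g := Complex.ofReal) (by simp)
  have hχ' : ContDiff ℝ (⊤ : ℕ∞) fun x => (χ x : ℂ) := Complex.ofRealCLM.contDiff.comp hχ
  let χS : 𝓢(E, ℂ) := hχs'.toSchwartzMap hχ'
  have hχS : ∀ x, χS x = χ x := fun x => rfl
  -- Since `χ` is real, `f` is Hermitian, and `f * f` has Fourier transform `χ²`.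
  let f : 𝓢(E, ℂ) := 𝓕⁻ χS
  have hf : ∀ x, f (-x) = (starRingEnd ℂ) (f x) := by
    intro x
    simp only [f, SchwartzMap.fourierInv_coe, Real.fourierInv_eq']
    rw [← integral_conj]
    refine integral_congr_ae (Eventually.of_forall fun y => ?_)
    simp [hχS, ← Complex.exp_conj, Complex.conj_ofNat]
  have h := re_integral_convolution_nonneg hc hΦ f hf
  rw [heq] at h
  have h2 : ∀ w, (ψ w : ℂ) * 𝓕 (SchwartzMap.convolution (.mul ℂ ℂ) f f) w =
      ((ψ w * χ w ^ 2 : ℝ) : ℂ) := by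
    intro w
    rw [SchwartzMap.fourier_convolution]
    simp [f, SchwartzMap.pairing_apply_apply, hχS, sq]
  simp only [h2] at h
  rwa [integral_complex_ofReal, Complex.ofReal_re] at h
end

lemma exists_schwartzMap_eq_ofReal {E : Type*} [NormedAddCommGroup E] [NormedSpace ℝ E]
    {χ : E → ℝ} (hχ : ContDiff ℝ (⊤ : ℕ∞) χ)
    (hχs : HasCompactSupport χ) : ∃ γ : 𝓢(E, ℂ), ∀ x, γ x = χ x :=
  ⟨(hχs.comp_left (g := Complex.ofReal) (by simp)).toSchwartzMap
    (Complex.ofRealCLM.contDiff.comp hχ), fun _ => rfl⟩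

lemma exists_contDiffBump_tendsto_indicator {E : Type*} [NormedAddCommGroup E]
    [InnerProductSpace ℝ E] [FiniteDimensional ℝ E] (x : E) {r : ℝ} (hr : 0 < r) :
    ∃ b : ℕ → ContDiffBump x, (∀ n, (b n).rOut ≤ r + 1) ∧
      ∀ y, Tendsto (fun n => b n y) atTop (𝓝 ((Metric.closedBall x r).indicator 1 y)) := by
  refine ⟨fun n => ⟨r, r + 1 / ((n : ℝ) + 1), hr, by simp; positivity⟩, fun n => ?_, fun y => ?_⟩
  · have : 1 / ((n : ℝ) + 1) ≤ 1 := by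
      rw [div_le_one (by positivity)]; linarith [n.cast_nonneg (α := ℝ)]
    simpa using this
  · by_cases hy : y ∈ Metric.closedBall x r
    · refine tendsto_const_nhds.congr fun n => ?_
      rw [Set.indicator_of_mem hy, ContDiffBump.one_of_mem_closedBall _ hy, Pi.one_apply]
    · rw [Set.indicator_of_notMem hy]
      refine tendsto_const_nhds.congr' ?_
      have hlt : 0 < dist y x - r := by simpa using hy
      filter_upwards [(tendsto_order.1 tendsto_one_div_add_atTop_nhds_zero_nat).2 _ hlt] with n hn
      refine (ContDiffBump.zero_of_le_dist _ ?_).symm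
      change r + 1 / ((n : ℝ) + 1) ≤ dist y x
      linarith

section
open scoped FourierTransform
variable {E : Type} [NormedAddCommGroup E] [InnerProductSpace ℝ E] [FiniteDimensional ℝ E]
  [MeasurableSpace E] [BorelSpace E] {Φ ψ : E → ℝ}

lemma locallyIntegrable_of_integrable_mul_schwartzMap
    (hint : ∀ γ : 𝓢(E, ℂ), Integrable fun w => (ψ w : ℂ) * γ w) : LocallyIntegrable ψ := by
  rw [locallyIntegrable_iff]
  intro K hK
  obtain ⟨R, hR, hKR⟩ := hK.isBounded.subset_closedBall_lt 0 0
  let b : ContDiffBump (0 : E) := ⟨R, R + 1, hR, by linarith⟩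
  obtain ⟨γ, hγ⟩ := exists_schwartzMap_eq_ofReal b.contDiff b.hasCompactSupport
  have := (hint γ).re.integrableOn (s := K)
  refine this.congr_fun (fun w hw => ?_) hK.measurableSet
  have hb : b w = 1 := b.one_of_mem_closedBall (hKR hw)
  simp [hγ, hb]

/-- A locally integrable function with nonnegative integrals against squares of test functions is
nonnegative almost everywhere. -/
lemma ae_nonneg_of_integral_mul_sq_nonneg (hψ : LocallyIntegrable ψ)
    (h : ∀ χ : E → ℝ, ContDiff ℝ (⊤ : ℕ∞) χ → HasCompactSupport χ → 0 ≤ ∫ w, ψ w * χ w ^ 2) :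
    ∀ᵐ w, 0 ≤ ψ w := by
  have hball : ∀ (x : E) (r : ℝ), 0 < r → 0 ≤ ∫ w in Metric.closedBall x r, ψ w := by
    intro x r hr
    obtain ⟨b, hb, hlim⟩ := exists_contDiffBump_tendsto_indicator x hr
    have ht : Tendsto (fun n => ∫ w, ψ w * b n w ^ 2) atTop
        (𝓝 (∫ w, (Metric.closedBall x r).indicator ψ w)) := by
      refine tendsto_integral_of_dominated_convergence
        ((Metric.closedBall x (r + 1)).indicator fun w => ‖ψ w‖) (fun n => ?_) ?_ (fun n => ?_) ?_
      · exact hψ.aestronglyMeasurable.mul ((b n).continuous.pow 2).aestronglyMeasurable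
      · rw [integrable_indicator_iff Metric.isClosed_closedBall.measurableSet]
        exact (hψ.integrableOn_isCompact (isCompact_closedBall _ _)).norm
      · refine Eventually.of_forall fun w => ?_
        by_cases hw : w ∈ Metric.closedBall x (r + 1)
        · rw [Set.indicator_of_mem hw, norm_mul]
          refine mul_le_of_le_one_right (norm_nonneg _) ?_
          rw [norm_pow, Real.norm_of_nonneg (b n).nonneg]
          exact pow_le_one₀ (b n).nonneg (b n).le_one
        · rw [Set.indicator_of_notMem hw, (b n).zero_of_le_dist]
          · simp
          · rw [Metric.mem_closedBall, not_le] at hw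
            exact (hb n).trans hw.le
      · refine Eventually.of_forall fun w => ?_
        convert! ((hlim w).pow 2).const_mul (ψ w) using 2
        by_cases hw : w ∈ Metric.closedBall x r <;> simp [hw]
    rw [integral_indicator Metric.isClosed_closedBall.measurableSet] at ht
    exact ge_of_tendsto' ht fun n => h _ (b n).contDiff (b n).hasCompactSupport
  -- Lebesgue differentiation: almost everywhere `ψ` is a limit of its averages over balls.
  filter_upwards [IsUnifLocDoublingMeasure.ae_tendsto_average (μ := volume) hψ 1] with x hx
  have hδ : Tendsto (fun n : ℕ => 1 / ((n : ℝ) + 1)) atTop (𝓝[>] 0) :=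
    tendsto_nhdsWithin_iff.2 ⟨tendsto_one_div_add_atTop_nhds_zero_nat,
      Eventually.of_forall fun n => by simp; positivity⟩
  refine ge_of_tendsto' (hx (fun _ => x) _ hδ (Eventually.of_forall fun n => ?_)) fun n => ?_
  · exact Metric.mem_closedBall_self (by positivity)
  · rw [setAverage_eq]
    exact smul_nonneg (by positivity) (hball x _ (by positivity))

lemma integral_norm_fourierInv_comp_smul (g : E → ℂ) {R : ℝ} (hR : 0 < R) :
    ∫ w, ‖𝓕⁻ (fun v => g (R⁻¹ • v)) w‖ = ∫ w, ‖𝓕⁻ g w‖ := by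
  have h1 : ∀ w, 𝓕⁻ (fun v => g (R⁻¹ • v)) w =
      (R ^ Module.finrank ℝ E : ℝ) • 𝓕⁻ g (R • w) := by
    intro w
    rw [Real.fourierInv_eq, Real.fourierInv_eq]
    have := Measure.integral_comp_inv_smul volume
      (fun v => Real.fourierChar (inner ℝ v (R • w)) • g v) R
    rw [abs_of_pos (by positivity)] at this
    rw [← this]
    refine integral_congr_ae (Eventually.of_forall fun v => ?_)
    simp only [inner_smul_left, inner_smul_right, conj_trivial]
    rw [mul_inv_cancel_left₀ hR.ne']
  simp only [h1, norm_smul]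
  rw [integral_const_mul, Measure.integral_comp_smul volume (fun w => ‖𝓕⁻ g w‖) R,
    abs_of_pos (by positivity), Real.norm_of_nonneg (by positivity), smul_eq_mul,
    mul_inv_cancel_left₀ (by positivity)]

/-- Pairing `ψ` with a bump dilated by `R` equals pairing `Φ` with the inverse transform of that
bump. The `L¹` norm of the latter does not depend on `R`, so the integrals of `ψ ≥ 0` over growing
balls stay bounded. -/
lemma integrable_of_bounded_fourier {M : ℝ} (hM : ∀ x, |Φ x| ≤ M)
    (hint : ∀ γ : 𝓢(E, ℂ), Integrable fun w => (ψ w : ℂ) * γ w)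
    (heq : ∀ γ : 𝓢(E, ℂ), ∫ x, (Φ x : ℂ) * γ x = ∫ w, (ψ w : ℂ) * 𝓕 γ w)
    (hψ : ∀ᵐ w, 0 ≤ ψ w) : Integrable ψ := by
  have hloc := locallyIntegrable_of_integrable_mul_schwartzMap hint
  let b : ContDiffBump (0 : E) := ⟨1, 2, one_pos, one_lt_two⟩
  have hcov : AECover (volume : Measure E) atTop
      fun n : ℕ => Metric.closedBall (0 : E) ((n : ℝ) + 1) :=
    aecover_closedBall (tendsto_atTop_add_const_right _ _ tendsto_natCast_atTop_atTop)
  refine hcov.integrable_of_integral_bounded_of_nonneg_ae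
    (M * ∫ w, ‖𝓕⁻ (fun v => (b v : ℂ)) w‖) (fun n => hloc.integrableOn_isCompact
      (isCompact_closedBall _ _)) hψ (Eventually.of_forall fun n => ?_)
  set R : ℝ := (n : ℝ) + 1 with hRdef
  have hR : 0 < R := by positivity
  have hcd : ContDiff ℝ (⊤ : ℕ∞) fun v => b (R⁻¹ • v) := b.contDiff.comp (contDiff_const_smul _)
  have hcs : HasCompactSupport fun v => b (R⁻¹ • v) :=
    b.hasCompactSupport.comp_smul (inv_ne_zero hR.ne')
  obtain ⟨γ, hγ⟩ := exists_schwartzMap_eq_ofReal hcd hcs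
  have h1 := heq (𝓕⁻ γ)
  rw [FourierTransform.fourier_fourierInv_eq] at h1
  have hre : ∀ w, (ψ w : ℂ) * γ w = ((ψ w * b (R⁻¹ • w) : ℝ) : ℂ) := fun w => by simp [hγ]
  simp only [hre] at h1
  rw [integral_complex_ofReal] at h1
  have hi : Integrable fun w => ψ w * b (R⁻¹ • w) := by
    have := (hint γ).re
    simpa [hre] using this
  calc ∫ w in Metric.closedBall 0 R, ψ w
      = ∫ w in Metric.closedBall 0 R, ψ w * b (R⁻¹ • w) := by
        refine setIntegral_congr_fun Metric.isClosed_closedBall.measurableSet fun w hw => ?_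
        have hb : b (R⁻¹ • w) = 1 := by
          refine b.one_of_mem_closedBall ?_
          change R⁻¹ • w ∈ Metric.closedBall 0 1
          rw [mem_closedBall_zero_iff] at hw ⊢
          rwa [norm_smul, norm_inv, Real.norm_of_nonneg hR.le, inv_mul_le_one₀ hR]
        simp [hb]
    _ ≤ ∫ w, ψ w * b (R⁻¹ • w) :=
        setIntegral_le_integral hi (hψ.mono fun w hw => mul_nonneg hw b.nonneg)
    _ ≤ ‖((∫ w, ψ w * b (R⁻¹ • w) : ℝ) : ℂ)‖ := by
        rw [Complex.norm_real]; exact le_abs_self _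
    _ = ‖∫ x, (Φ x : ℂ) * 𝓕⁻ γ x‖ := by rw [h1]
    _ ≤ ∫ x, M * ‖𝓕⁻ γ x‖ := by
        refine norm_integral_le_of_norm_le ((𝓕⁻ γ).integrable.norm.const_mul M)
          (Eventually.of_forall fun x => ?_)
        rw [norm_mul, Complex.norm_real]
        exact mul_le_mul_of_nonneg_right (hM x) (norm_nonneg _)
    _ = M * ∫ w, ‖𝓕⁻ (fun v => (b v : ℂ)) w‖ := by
        rw [integral_const_mul, ← integral_norm_fourierInv_comp_smul (fun v => (b v : ℂ)) hR]
        have : ⇑γ = fun v => (b (R⁻¹ • v) : ℂ) := funext hγ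
        rw [SchwartzMap.fourierInv_coe, this]

lemma integral_fourier_mul_schwartzMap {f : E → ℂ} (hf : Integrable f) (γ : 𝓢(E, ℂ)) :
    ∫ x, 𝓕 f x * γ x = ∫ w, f w * 𝓕 γ w := by
  simpa using! VectorFourier.integral_bilin_fourierIntegral_eq_flip (.mul ℂ ℂ) (L := innerₗ E)
    Real.continuous_fourierChar continuous_inner hf γ.integrable

lemma continuous_fourier {f : E → ℂ} (hf : Integrable f) : Continuous (𝓕 f) :=
  VectorFourier.fourierIntegral_continuous Real.continuous_fourierChar continuous_inner hf

/-- Both sides are continuous and agree against all test functions. -/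
lemma ofReal_eq_fourier (hc : Continuous Φ) (hψ : Integrable ψ)
    (heq : ∀ γ : 𝓢(E, ℂ), ∫ x, (Φ x : ℂ) * γ x = ∫ w, (ψ w : ℂ) * 𝓕 γ w) (x : E) :
    (Φ x : ℂ) = 𝓕 (fun w => (ψ w : ℂ)) x := by
  have hF := continuous_fourier (f := fun w => (ψ w : ℂ)) hψ.ofReal
  have hΦ : Continuous fun x => (Φ x : ℂ) := by fun_prop
  have hae := ae_eq_of_integral_contDiff_smul_eq (μ := volume) hΦ.locallyIntegrable
    hF.locallyIntegrable fun g hg hgs => by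
      obtain ⟨γ, hγ⟩ := exists_schwartzMap_eq_ofReal hg hgs
      have := (heq γ).trans (integral_fourier_mul_schwartzMap hψ.ofReal γ).symm
      simpa [hγ, mul_comm, Complex.real_smul] using this
  exact congrFun (Continuous.ae_eq_iff_eq volume hΦ hF |>.1 hae) x

/-- **Bochner's theorem** for continuous positive definite functions whose distributional Fourier
transform is a function. -/
theorem bochner (hc : Continuous Φ) (hΦ : IsKernel fun x y => Φ (x - y))
    (hint : ∀ γ : 𝓢(E, ℂ), Integrable fun w => (ψ w : ℂ) * γ w)
    (heq : ∀ γ : 𝓢(E, ℂ), ∫ x, (Φ x : ℂ) * γ x = ∫ w, (ψ w : ℂ) * 𝓕 γ w) :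
    (∀ᵐ w, 0 ≤ ψ w) ∧ Integrable ψ ∧ ∀ x, (Φ x : ℂ) = 𝓕 (fun w => (ψ w : ℂ)) x := by
  have hpos := ae_nonneg_of_integral_mul_sq_nonneg
    (locallyIntegrable_of_integrable_mul_schwartzMap hint)
    fun χ hχ hχs => integral_mul_sq_nonneg hc hΦ heq hχ hχs
  have hi := integrable_of_bounded_fourier (abs_le_of_isKernel_sub hΦ) hint heq hpos
  exact ⟨hpos, hi, ofReal_eq_fourier hc hi heq⟩

end

/-! ### Parseval's identity and convolution squares. -/

section
open scoped FourierTransform ComplexInnerProductSpace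
variable {E : Type} [NormedAddCommGroup E] [InnerProductSpace ℝ E] [FiniteDimensional ℝ E]
  [MeasurableSpace E] [BorelSpace E]

/-- On `L¹ ∩ L²`, the Fourier transform on `L²` is given by the Fourier integral. -/
lemma coeFn_fourier_toLp {f : E → ℂ} (hf : Integrable f) (hf2 : MemLp f 2) :
    ((𝓕 (hf2.toLp f) : Lp (α := E) ℂ 2) : E → ℂ) =ᵐ[volume] 𝓕 f := by
  refine ae_eq_of_integral_contDiff_smul_eq (μ := volume)
    ((Lp.memLp _).locallyIntegrable one_le_two) (continuous_fourier hf).locallyIntegrable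
    fun g hg hgs => ?_
  obtain ⟨γ, hγ⟩ := exists_schwartzMap_eq_ofReal hg hgs
  have h := DFunLike.congr_fun (Lp.fourier_toTemperedDistribution_eq (hf2.toLp f)) γ
  rw [TemperedDistribution.fourier_apply, Lp.toTemperedDistribution_apply,
    Lp.toTemperedDistribution_apply] at h
  have h2 : ∫ x, 𝓕 γ x • (hf2.toLp f) x = ∫ x, f x * 𝓕 γ x :=
    integral_congr_ae (hf2.coeFn_toLp.mono fun x hx => by simp only [hx, smul_eq_mul, mul_comm])
  rw [h2, ← integral_fourier_mul_schwartzMap hf] at h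
  simpa [hγ, mul_comm, Complex.real_smul] using h.symm

lemma memLp_two_fourier {f : E → ℂ} (hf : Integrable f) (hf2 : MemLp f 2) : MemLp (𝓕 f) 2 :=
  (memLp_congr_ae (coeFn_fourier_toLp hf hf2)).1 (Lp.memLp _)

/-- Parseval's identity on `L¹ ∩ L²`. -/
lemma integral_conj_fourier_mul_fourier {f g : E → ℂ} (hf : Integrable f) (hf2 : MemLp f 2)
    (hg : Integrable g) (hg2 : MemLp g 2) :
    ∫ z, (starRingEnd ℂ) (𝓕 f z) * 𝓕 g z = ∫ w, (starRingEnd ℂ) (f w) * g w := by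
  have h := Lp.inner_fourier_eq (hf2.toLp f) (hg2.toLp g)
  rw [L2.inner_def, L2.inner_def] at h
  calc _ = ∫ a, ⟪(𝓕 (hf2.toLp f) : Lp (α := E) ℂ 2 volume) a,
        (𝓕 (hg2.toLp g) : Lp (α := E) ℂ 2 volume) a⟫ := by
        refine integral_congr_ae ?_
        filter_upwards [coeFn_fourier_toLp hf hf2, coeFn_fourier_toLp hg hg2] with z h1 h2
        rw [h1, h2, RCLike.inner_apply, mul_comm]
    _ = _ := h
    _ = _ := by
        refine integral_congr_ae ?_
        filter_upwards [hf2.coeFn_toLp, hg2.coeFn_toLp] with z h1 h2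
        rw [h1, h2, RCLike.inner_apply, mul_comm]

variable {Φ ψ : E → ℝ}

lemma memLp_two_of_eq_fourier (hψ : Integrable ψ) (hψ2 : MemLp ψ 2)
    (hΦ : ∀ x, (Φ x : ℂ) = 𝓕 (fun w => (ψ w : ℂ)) x) : MemLp Φ 2 := by
  have := (memLp_two_fourier (f := fun w => (ψ w : ℂ)) hψ.ofReal hψ2.ofReal).re
  refine (memLp_congr_ae (Eventually.of_forall fun x => ?_)).1 this
  simp [← hΦ]

lemma integrable_comp_sub_mul_comp_sub (hΦ : MemLp Φ 2) (x y : E) :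
    Integrable fun z => Φ (x - z) * Φ (y - z) :=
  MemLp.integrable_mul (hΦ.comp_measurePreserving (Measure.measurePreserving_sub_left volume x))
    (hΦ.comp_measurePreserving (Measure.measurePreserving_sub_left volume y))

lemma fourier_fourierChar_mul (f : E → ℂ) (x z : E) :
    𝓕 (fun w => (Real.fourierChar (inner ℝ w x) : ℂ) * f w) z = 𝓕 f (z - x) := by
  rw [Real.fourier_eq, Real.fourier_eq]
  refine integral_congr_ae (Eventually.of_forall fun w => ?_)
  simp only [Circle.smul_def, smul_eq_mul, ← mul_assoc, ← Circle.coe_mul,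
    ← AddChar.map_add_eq_mul, inner_sub_right]
  congr 4
  ring

/-- By evenness, `z ↦ Φ (x - z)` is the transform of `ψ` modulated by the character of `x`. Parseval
turns the integral into one of `ψ²` times the product of two characters, which is the character of
`x - y`. -/
lemma ofReal_integral_comp_sub_mul_comp_sub (hψ : Integrable ψ) (hψ2 : MemLp ψ 2)
    (hΦ : ∀ x, (Φ x : ℂ) = 𝓕 (fun w => (ψ w : ℂ)) x) (heven : ∀ x, Φ (-x) = Φ x) (x y : E) :
    ((∫ z, Φ (x - z) * Φ (y - z) : ℝ) : ℂ) = 𝓕 (fun w => ((ψ w ^ 2 : ℝ) : ℂ)) (x - y) := by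
  let m : E → E → ℂ := fun x w => (Real.fourierChar (inner ℝ w x) : ℂ) * (ψ w : ℂ)
  have hcont : ∀ x : E, Continuous fun w : E => (Real.fourierChar (inner ℝ w x) : ℂ) := fun x => by
    simp only [Real.fourierChar_apply]
    fun_prop
  have hm : ∀ x, Integrable (m x) := fun x =>
    hψ.ofReal.bdd_mul (c := 1) (hcont x).aestronglyMeasurable
      (Eventually.of_forall fun w => (Circle.norm_coe _).le)
  have hm2 : ∀ x, MemLp (m x) 2 := fun x => by
    refine (hψ2.ofReal (K := ℂ)).of_le_mul (c := 1) (hm x).1 (Eventually.of_forall fun w => ?_)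
    rw [norm_mul, Circle.norm_coe, one_mul, one_mul]
    exact le_rfl
  have h := integral_conj_fourier_mul_fourier (hm x) (hm2 x) (hm y) (hm2 y)
  have hF : ∀ x z, 𝓕 (m x) z = (Φ (x - z) : ℂ) := fun x z => by
    rw [fourier_fourierChar_mul, ← hΦ, ← heven, neg_sub]
  simp only [hF, Complex.conj_ofReal, ← Complex.ofReal_mul] at h
  rw [integral_complex_ofReal] at h
  rw [h, Real.fourier_eq]
  refine integral_congr_ae (Eventually.of_forall fun w => ?_)
  have he : -inner ℝ w (x - y) = -inner ℝ w x + inner ℝ w y := by rw [inner_sub_right]; ring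
  simp only [m, map_mul, Complex.conj_ofReal, ← Circle.coe_inv_eq_conj, ← AddChar.map_neg_eq_inv,
    Circle.smul_def, smul_eq_mul, he, AddChar.map_add_eq_mul, Circle.coe_mul]
  push_cast
  ring

lemma re_fourier_ofReal (hψ : Integrable ψ) (x : E) :
    (𝓕 (fun w => (ψ w : ℂ)) x).re = ∫ w, ψ w * Real.cos (2 * Real.pi * inner ℝ w x) := by
  have hi := (Real.fourierIntegral_convergent_iff (μ := volume) x).2 (hψ.ofReal (𝕜 := ℂ))
  rw [Real.fourier_eq]
  refine (integral_re hi).symm.trans (integral_congr_ae (Eventually.of_forall fun w => ?_))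
  simp [Circle.smul_def, Real.fourierChar_apply, Complex.exp_re]
  exact mul_comm _ _

/-- The Fourier transform of a nonnegative integrable function is positive definite. -/
lemma isKernel_of_eq_fourier {K : E → E → ℝ} (hψ : Integrable ψ) (hpos : ∀ᵐ w, 0 ≤ ψ w)
    (hK : ∀ x y, (K x y : ℂ) = 𝓕 (fun w => (ψ w : ℂ)) (x - y)) : IsKernel K := by
  have hcos : ∀ x y, K x y = ∫ w, ψ w * Real.cos (2 * Real.pi * inner ℝ w (x - y)) := fun x y => by
    rw [← re_fourier_ofReal hψ, ← hK, Complex.ofReal_re]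
  have hi : ∀ x, Integrable fun w => ψ w * Real.cos (2 * Real.pi * inner ℝ w x) := fun x =>
    hψ.mul_bdd (c := 1) (Continuous.aestronglyMeasurable (by fun_prop))
      (Eventually.of_forall fun w => Real.abs_cos_le_one _)
  intro l z
  refine Matrix.PosSemidef.of_dotProduct_mulVec_nonneg ?_ fun v => ?_
  · ext i j
    simp only [Matrix.conjTranspose_apply, Matrix.of_apply, star_trivial, hcos]
    refine integral_congr_ae (Eventually.of_forall fun w => ?_)
    simp only
    rw [← Real.cos_neg, ← mul_neg, ← inner_neg_right, neg_sub]
  · simp only [dotProduct, Matrix.mulVec, Matrix.of_apply, Pi.star_apply, star_trivial,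
      Finset.mul_sum, hcos]
    have : ∀ i j, v i * ((∫ w, ψ w * Real.cos (2 * Real.pi * inner ℝ w (z i - z j))) * v j) =
        ∫ w, v i * v j * (ψ w * Real.cos (2 * Real.pi * inner ℝ w (z i - z j))) := fun i j => by
      rw [integral_const_mul]; ring
    simp only [this]
    simp_rw [← integral_finsetSum Finset.univ fun j _ => (hi (z _ - z j)).const_mul (v _ * v j)]
    rw [← integral_finsetSum Finset.univ fun i _ => integrable_finsetSum _
      fun j _ => (hi (z i - z j)).const_mul (v i * v j)]
    refine integral_nonneg_of_ae (hpos.mono fun w hw => ?_)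
    -- The addition formula for the cosine splits the quadratic form into two squares.
    have key : ∑ i, ∑ j, v i * v j * (ψ w * Real.cos (2 * Real.pi * inner ℝ w (z i - z j))) =
        ψ w * ((∑ i, v i * Real.cos (2 * Real.pi * inner ℝ w (z i))) ^ 2 +
          (∑ i, v i * Real.sin (2 * Real.pi * inner ℝ w (z i))) ^ 2) := by
      rw [sq, sq, Finset.sum_mul_sum, Finset.sum_mul_sum, ← Finset.sum_add_distrib, Finset.mul_sum]
      refine Finset.sum_congr rfl fun i _ => ?_
      rw [← Finset.sum_add_distrib, Finset.mul_sum]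
      refine Finset.sum_congr rfl fun j _ => ?_
      rw [inner_sub_right, mul_sub, Real.cos_sub]
      ring
    simp only [Pi.zero_apply]
    rw [key]
    positivity

/-- The Fourier transform of an integrable function is positive definite if and only if the function
is nonnegative. -/
theorem isKernel_iff_of_eq_fourier (hψ : Integrable ψ)
    (hΦ : ∀ x, (Φ x : ℂ) = 𝓕 (fun w => (ψ w : ℂ)) x) :
    IsKernel (fun x y => Φ (x - y)) ↔ ∀ᵐ w, 0 ≤ ψ w := by
  refine ⟨fun h => ?_, fun h => isKernel_of_eq_fourier hψ h fun x y => hΦ _⟩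
  have hc : Continuous Φ := by
    have : Φ = fun x => (𝓕 (fun w => (ψ w : ℂ)) x).re :=
      funext fun x => by rw [← hΦ, Complex.ofReal_re]
    rw [this]
    exact Complex.continuous_re.comp (continuous_fourier hψ.ofReal)
  refine (bochner hc h (fun γ => ?_) fun γ => ?_).1
  · exact (hψ.ofReal (𝕜 := ℂ)).mul_bdd (c := SchwartzMap.seminorm ℝ 0 0 γ)
      γ.continuous.aestronglyMeasurable
      (Eventually.of_forall fun w => SchwartzMap.norm_le_seminorm ℝ γ w)
  · simp only [hΦ]
    exact integral_fourier_mul_schwartzMap hψ.ofReal γ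

end

lemma exists_schwartzMap_comp_smul {E : Type*} [NormedAddCommGroup E] [NormedSpace ℝ E]
    (γ : 𝓢(E, ℂ)) {r : ℝ} (hr : r ≠ 0) :
    ∃ η : 𝓢(E, ℂ), ∀ x, η x = γ (r • x) :=
  ⟨SchwartzMap.compCLMOfContinuousLinearEquiv ℂ
    (ContinuousLinearEquiv.smulLeft (Units.mk0 r hr)) γ, fun _ => rfl⟩

section
open scoped FourierTransform
variable {E : Type} [NormedAddCommGroup E] [InnerProductSpace ℝ E] [FiniteDimensional ℝ E]
  [MeasurableSpace E] [BorelSpace E]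

/-- The difference of a convolution square and a multiple of a shift invariant kernel is positive
definite if and only if the corresponding inequality holds between the Fourier transforms. -/
theorem isKernel_integral_sub_mul_iff {Φ Φrt ψ ψrt : E → ℝ} (hψ : Integrable ψ)
    (hΦ : ∀ x, (Φ x : ℂ) = 𝓕 (fun w => (ψ w : ℂ)) x) (hψrt : Integrable ψrt)
    (hψrt2 : MemLp ψrt 2) (hΦrt : ∀ x, (Φrt x : ℂ) = 𝓕 (fun w => (ψrt w : ℂ)) x)
    (heven : ∀ x, Φrt (-x) = Φrt x) (c : ℝ) :
    IsKernel (fun x y => (∫ z, Φrt (x - z) * Φrt (y - z)) - c * Φ (x - y)) ↔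
      ∀ᵐ w, c * ψ w ≤ ψrt w ^ 2 := by
  have hconv := ofReal_integral_comp_sub_mul_comp_sub hψrt hψrt2 hΦrt heven
  -- The integral depends only on `x - y`, so the whole difference is the shift-invariant kernel of
  -- `G`.
  let G : E → ℝ := fun x => (∫ z, Φrt (x - z) * Φrt (0 - z)) - c * Φ x
  have hG : (fun x y => (∫ z, Φrt (x - z) * Φrt (y - z)) - c * Φ (x - y)) =
      fun x y => G (x - y) := by
    funext x y
    have h : ∫ z, Φrt (x - z) * Φrt (y - z) = ∫ z, Φrt (x - y - z) * Φrt (0 - z) := by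
      apply Complex.ofReal_injective
      rw [hconv, hconv, sub_zero]
    simp only [G, h]
  have hsq : Integrable fun w => ψrt w ^ 2 := hψrt2.integrable_sq
  rw [hG, isKernel_iff_of_eq_fourier (ψ := fun w => ψrt w ^ 2 - c * ψ w)
    (hsq.sub (hψ.const_mul c)) fun x => ?_]
  · simp only [sub_nonneg]
  · simp only [G]
    rw [Complex.ofReal_sub, hconv, sub_zero, Complex.ofReal_mul, hΦ, Real.fourier_eq,
      Real.fourier_eq, Real.fourier_eq, ← integral_const_mul, ← integral_sub]
    · refine integral_congr_ae (Eventually.of_forall fun w => ?_)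
      simp only [Circle.smul_def, smul_eq_mul]
      push_cast
      ring
    · exact (Real.fourierIntegral_convergent_iff (μ := volume) x).2 (hsq.ofReal (𝕜 := ℂ))
    · exact ((Real.fourierIntegral_convergent_iff (μ := volume) x).2
        (hψ.ofReal (𝕜 := ℂ))).const_mul _

end

/-! ### Change of Fourier normalization and the essential supremum. -/

section
open scoped FourierTransform
variable {d : ℕ}

lemma unitaryFourier_comp_inv_smul (f : EuclideanSpace ℝ (Fin d) → ℂ)
    (x : EuclideanSpace ℝ (Fin d)) :
    unitaryFourier (fun ω => f ((2 * Real.pi)⁻¹ • ω)) x =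
      (((2 * Real.pi) ^ ((d : ℝ) / 2) : ℝ) : ℂ) * 𝓕 f x := by
  have hp : 0 < 2 * Real.pi := by positivity
  have h := Measure.integral_comp_inv_smul (volume : Measure (EuclideanSpace ℝ (Fin d)))
    (fun v => Real.fourierChar (-inner ℝ v x) • f v) (2 * Real.pi)
  rw [abs_of_pos (by positivity), finrank_euclideanSpace_fin, ← Real.fourier_eq] at h
  have h2 : ∫ ω, f ((2 * Real.pi)⁻¹ • ω) * Complex.exp (-Complex.I * ((inner ℝ ω x : ℝ) : ℂ)) =
      ∫ ω, Real.fourierChar (-inner ℝ ((2 * Real.pi)⁻¹ • ω) x) • f ((2 * Real.pi)⁻¹ • ω) := by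
    refine integral_congr_ae (Eventually.of_forall fun ω => ?_)
    simp only [Circle.smul_def, smul_eq_mul, Real.fourierChar_apply, inner_smul_left, conj_trivial]
    rw [mul_neg, mul_inv_cancel_left₀ hp.ne', mul_comm]
    congr 2
    push_cast
    ring
  rw [unitaryFourier, h2, h, Complex.real_smul, ← mul_assoc, ← Complex.ofReal_mul,
    ← Real.rpow_natCast, ← Real.rpow_add hp]
  congr 3
  ring

/-- The density of the Fourier transform in the normalization `∫ f(x) exp(-2πi⟨x, ω⟩) dx`
corresponding to a density in the unitary angular frequency convention. -/
noncomputable def rescaledDensity (Ψ : EuclideanSpace ℝ (Fin d) → ℝ)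
    (w : EuclideanSpace ℝ (Fin d)) : ℝ :=
  (2 * Real.pi) ^ ((d : ℝ) / 2) * Ψ ((2 * Real.pi) • w)

variable {Φ Ψ : EuclideanSpace ℝ (Fin d) → ℝ}

lemma IsGeneralizedFourierTransform.integrable_mul_schwartzMap
    (h : IsGeneralizedFourierTransform 0 (fun x => (Φ x : ℂ)) (fun ω => (Ψ ω : ℂ)))
    (γ : 𝓢(EuclideanSpace ℝ (Fin d), ℂ)) : Integrable fun ω => (Ψ ω : ℂ) * γ ω := by
  refine h.integrable_mul γ ?_
  simpa using (γ.continuous.tendsto 0).isBigO_one ℝ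

lemma IsGeneralizedFourierTransform.integral_unitaryFourier
    (h : IsGeneralizedFourierTransform 0 (fun x => (Φ x : ℂ)) (fun ω => (Ψ ω : ℂ)))
    (γ : 𝓢(EuclideanSpace ℝ (Fin d), ℂ)) :
    ∫ x, (Φ x : ℂ) * unitaryFourier γ x = ∫ ω, (Ψ ω : ℂ) * γ ω := by
  refine h.integral_eq γ ?_
  simpa using (γ.continuous.tendsto 0).isBigO_one ℝ

lemma integrable_rescaledDensity_mul
    (h : IsGeneralizedFourierTransform 0 (fun x => (Φ x : ℂ)) (fun ω => (Ψ ω : ℂ)))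
    (γ : 𝓢(EuclideanSpace ℝ (Fin d), ℂ)) : Integrable fun w => (rescaledDensity Ψ w : ℂ) * γ w := by
  have hp : (2 * Real.pi : ℝ) ≠ 0 := by positivity
  obtain ⟨η, hη⟩ := exists_schwartzMap_comp_smul γ (inv_ne_zero hp)
  have := ((h.integrable_mul_schwartzMap η).comp_smul hp).const_mul
    (((2 * Real.pi) ^ ((d : ℝ) / 2) : ℝ) : ℂ)
  refine this.congr (Eventually.of_forall fun w => ?_)
  simp only [hη, inv_smul_smul₀ hp, rescaledDensity, Complex.ofReal_mul, mul_assoc]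

/-- The defining identity is applied to the rescaled transform of `γ`. Transforming twice reflects
`γ`, which evenness of `Φ` absorbs, and the Jacobian `(2π)^d` is the product of the two factors
`(2π)^(d/2)`. -/
lemma integral_mul_schwartzMap_eq
    (h : IsGeneralizedFourierTransform 0 (fun x => (Φ x : ℂ)) (fun ω => (Ψ ω : ℂ)))
    (heven : ∀ x, Φ (-x) = Φ x) (γ : 𝓢(EuclideanSpace ℝ (Fin d), ℂ)) :
    ∫ x, (Φ x : ℂ) * γ x = ∫ w, (rescaledDensity Ψ w : ℂ) * 𝓕 γ w := by
  have hp : 0 < 2 * Real.pi := by positivity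
  obtain ⟨η, hη⟩ := exists_schwartzMap_comp_smul (𝓕 γ) (inv_ne_zero hp.ne')
  have h1 := h.integral_unitaryFourier η
  have hη' : ⇑η = fun ω => 𝓕 γ ((2 * Real.pi)⁻¹ • ω) := funext hη
  have hFF : ∀ x, 𝓕 (𝓕 (γ : EuclideanSpace ℝ (Fin d) → ℂ)) x = γ (-x) := fun x => by
    have := Real.fourierInv_eq_fourier_neg (𝓕 (γ : EuclideanSpace ℝ (Fin d) → ℂ)) (-x)
    rw [neg_neg] at this
    rw [← this, ← SchwartzMap.fourier_coe, ← SchwartzMap.fourierInv_coe,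
      FourierTransform.fourierInv_fourier_eq]
  have h2 : ∫ x, (Φ x : ℂ) * unitaryFourier η x =
      (((2 * Real.pi) ^ ((d : ℝ) / 2) : ℝ) : ℂ) * ∫ x, (Φ x : ℂ) * γ x := by
    rw [← integral_const_mul, ← integral_neg_eq_self]
    refine integral_congr_ae (Eventually.of_forall fun x => ?_)
    simp only [hη', unitaryFourier_comp_inv_smul, SchwartzMap.fourier_coe, hFF, neg_neg, heven]
    ring
  have h3 := Measure.integral_comp_smul (volume : Measure (EuclideanSpace ℝ (Fin d)))
    (fun ω => (Ψ ω : ℂ) * η ω) (2 * Real.pi)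
  simp only [hη, inv_smul_smul₀ hp.ne'] at h3
  rw [abs_of_pos (by positivity), finrank_euclideanSpace_fin, Complex.real_smul] at h3
  have hpow : (((2 * Real.pi) ^ ((d : ℝ) / 2) : ℝ) : ℂ) *
      (((2 * Real.pi) ^ ((d : ℝ) / 2) : ℝ) : ℂ) = (((2 * Real.pi) ^ d : ℝ) : ℂ) := by
    rw [← Complex.ofReal_mul, ← Real.rpow_add hp, add_halves, Real.rpow_natCast]
  have hne : (((2 * Real.pi) ^ ((d : ℝ) / 2) : ℝ) : ℂ) ≠ 0 :=
    Complex.ofReal_ne_zero.2 (by positivity)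
  have h4 : ∫ w, (rescaledDensity Ψ w : ℂ) * 𝓕 γ w = (((2 * Real.pi) ^ ((d : ℝ) / 2) : ℝ) : ℂ) *
      ∫ w, (Ψ ((2 * Real.pi) • w) : ℂ) * 𝓕 γ w := by
    rw [← integral_const_mul]
    refine integral_congr_ae (Eventually.of_forall fun w => ?_)
    simp only [rescaledDensity, Complex.ofReal_mul, mul_assoc]
  rw [h2] at h1
  rw [h4, h3]
  simp only [hη] at h1
  rw [← h1]
  rw [Complex.ofReal_inv, ← hpow]
  field_simp

lemma memLp_rescaledDensity (h : MemLp Ψ 2) : MemLp (rescaledDensity Ψ) 2 := by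
  have hp : (2 * Real.pi : ℝ) ≠ 0 := by positivity
  refine MemLp.const_mul (MemLp.comp_of_map (f := fun w => (2 * Real.pi) • w) ?_ (by fun_prop)) _
  rw [Measure.map_addHaar_smul volume hp]
  exact h.smul_measure ENNReal.ofReal_ne_top

lemma ae_comp_smul_iff {p : EuclideanSpace ℝ (Fin d) → Prop} {r : ℝ} (hr : r ≠ 0) :
    (∀ᵐ w, p (r • w)) ↔ ∀ᵐ w, p w := by
  rw [← (measurableEmbedding_const_smul₀ hr).ae_map_iff, Measure.map_addHaar_smul volume hr,
    Measure.ae_ennreal_smul_measure_iff]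
  simpa using pow_pos (abs_pos.2 hr) d

lemma essSup_div_lt_top_iff {α : Type*} [MeasurableSpace α] {μ : Measure α} {f g : α → ℝ}
    (hf : AEMeasurable f μ) :
    essSup (fun ω => ENNReal.ofReal (f ω) / ENNReal.ofReal (g ω ^ 2)) (μ.restrict {ω | 0 < f ω}) < ⊤
      ↔ ∃ c : ℝ, 0 < c ∧ ∀ᵐ ω ∂μ, c * f ω ≤ g ω ^ 2 := by
  have hs : NullMeasurableSet {ω | 0 < f ω} μ := nullMeasurableSet_lt aemeasurable_const hf
  constructor
  · intro h
    obtain ⟨M, hM, -⟩ := ENNReal.lt_iff_exists_nnreal_btwn.1 h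
    have hae := ae_lt_of_essSup_lt hM
    rw [ae_restrict_iff'₀ hs] at hae
    -- Adding `1` covers the case `M = 0`.
    refine ⟨((M : ℝ) + 1)⁻¹, by positivity, hae.mono fun ω hω => ?_⟩
    rw [inv_mul_le_iff₀ (by positivity)]
    rcases le_or_gt (f ω) 0 with h0 | h0
    · exact h0.trans (by positivity)
    · have h1 := (hω h0).le
      have h2 : ENNReal.ofReal (f ω) ≤ M * ENNReal.ofReal (g ω ^ 2) := by
        exact (ENNReal.div_le_iff_le_mul (Or.inr ENNReal.coe_ne_top)
          (Or.inl ENNReal.ofReal_ne_top)).1 h1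
      rw [← ENNReal.ofReal_coe_nnreal, ← ENNReal.ofReal_mul M.coe_nonneg,
        ENNReal.ofReal_le_ofReal_iff (mul_nonneg M.coe_nonneg (sq_nonneg _))] at h2
      linarith [sq_nonneg (g ω)]
  · rintro ⟨c, hc, hae⟩
    refine lt_of_le_of_lt (essSup_le_of_ae_le (ENNReal.ofReal c⁻¹) ?_) ENNReal.ofReal_lt_top
    refine (ae_restrict_of_ae hae).mono fun ω hω => ?_
    refine ENNReal.div_le_of_le_mul ?_
    rw [← ENNReal.ofReal_mul (by positivity)]
    refine ENNReal.ofReal_le_ofReal ?_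
    rwa [le_inv_mul_iff₀ hc]

end

theorem proposition4 (d : ℕ)
    (k krt : EuclideanSpace ℝ (Fin d) → EuclideanSpace ℝ (Fin d) → ℝ)
    (κ κrt κhat κrthat : EuclideanSpace ℝ (Fin d) → ℝ)
    (hk : IsKernel k) (hkrt : IsKernel krt)
    (hk_cont : Continuous fun p : EuclideanSpace ℝ (Fin d) × EuclideanSpace ℝ (Fin d) => k p.1 p.2)
    (hkrt_cont :
      Continuous fun p : EuclideanSpace ℝ (Fin d) × EuclideanSpace ℝ (Fin d) => krt p.1 p.2)
    (hκ : ∀ x y, k x y = κ (x - y)) (hκrt : ∀ x y, krt x y = κrt (x - y))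
    (hκhat : IsGeneralizedFourierTransform 0 (fun x => (κ x : ℂ)) (fun ω => (κhat ω : ℂ)))
    (hκrthat : IsGeneralizedFourierTransform 0 (fun x => (κrt x : ℂ)) (fun ω => (κrthat ω : ℂ)))
    (hκrthat_L2 : MemLp κrthat 2 volume) :
    (IsSqrtDominatingRKHS krt k ↔
      essSup (fun ω => ENNReal.ofReal (κhat ω) / ENNReal.ofReal (κrthat ω ^ 2))
        (volume.restrict {ω | 0 < κhat ω}) < ⊤) ∧
    (IsSqrtDominatingPD krt k ↔
      essSup (fun ω => ENNReal.ofReal (κhat ω) / ENNReal.ofReal (κrthat ω ^ 2))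
        (volume.restrict {ω | 0 < κhat ω}) < ⊤) := by
  obtain rfl : k = fun x y => κ (x - y) := funext fun x => funext fun y => hκ x y
  obtain rfl : krt = fun x y => κrt (x - y) := funext fun x => funext fun y => hκrt x y
  have hp : (2 * Real.pi : ℝ) ≠ 0 := by positivity
  have hc : Continuous κ := by
    have := Complex.continuous_re.comp hκhat.continuous
    exact this
  have hcrt : Continuous κrt := by
    have := Complex.continuous_re.comp hκrthat.continuous
    exact this
  obtain ⟨-, hi, hF⟩ := bochner hc hk (integrable_rescaledDensity_mul hκhat)
    (integral_mul_schwartzMap_eq hκhat (even_of_isKernel_sub hk))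
  obtain ⟨-, hirt, hFrt⟩ := bochner hcrt hkrt (integrable_rescaledDensity_mul hκrthat)
    (integral_mul_schwartzMap_eq hκrthat (even_of_isKernel_sub hkrt))
  have hrt2 := memLp_rescaledDensity hκrthat_L2
  have hconv : ∀ x y, Integrable fun z => κrt (x - z) * κrt (y - z) :=
    integrable_comp_sub_mul_comp_sub (memLp_two_of_eq_fourier hirt hrt2 hFrt)
  have hiff := isKernel_integral_sub_mul_iff hi hF hirt hrt2 hFrt (even_of_isKernel_sub hkrt)
  -- The case `c = 0` says that the dominating function is itself a kernel, as Aronszajn's theorem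
  -- requires.
  have hkt : IsKernel (sqrtDomKernel fun x y => κrt (x - y)) := by
    have := (hiff 0).2 (Eventually.of_forall fun w => by simpa using sq_nonneg _)
    simpa only [zero_mul, sub_zero] using! this
  have hPD : IsSqrtDominatingPD (fun x y => κrt (x - y)) (fun x y => κ (x - y)) ↔
      essSup (fun ω => ENNReal.ofReal (κhat ω) / ENNReal.ofReal (κrthat ω ^ 2))
        (volume.restrict {ω | 0 < κhat ω}) < ⊤ := by
    have hm : AEMeasurable κhat := Complex.measurable_re.comp_aemeasurable
      hκhat.aestronglyMeasurable.aemeasurable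
    rw [essSup_div_lt_top_iff hm, IsSqrtDominatingPD, and_iff_right hconv]
    have hs : 0 < (2 * Real.pi) ^ ((d : ℝ) / 2) := by positivity
    -- Rescaling puts one factor `(2π)^(d/2)` on the left of the inequality and two on the right, so
    -- `c` is divided by one of them.
    have hiff' : ∀ c, IsKernel (fun x y => sqrtDomKernel (fun x y => κrt (x - y)) x y -
        c * κ (x - y)) ↔ ∀ᵐ w, c / (2 * Real.pi) ^ ((d : ℝ) / 2) * κhat w ≤ κrthat w ^ 2 := by
      intro c
      rw [← ae_comp_smul_iff hp]
      refine (hiff c).trans (eventually_congr (Eventually.of_forall fun w => ?_))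
      simp only [rescaledDensity]
      rw [div_mul_eq_mul_div, div_le_iff₀ hs, mul_pow, sq, mul_assoc, mul_left_comm,
        mul_le_mul_iff_right₀ hs, mul_comm (κrthat _ ^ 2)]
    constructor
    · rintro ⟨c, hc0, hK⟩
      exact ⟨_, div_pos hc0 hs, (hiff' c).1 hK⟩
    · rintro ⟨c, hc0, hle⟩
      refine ⟨c * (2 * Real.pi) ^ ((d : ℝ) / 2), mul_pos hc0 hs, (hiff' _).2 ?_⟩
      rwa [mul_div_cancel_right₀ _ hs.ne']
  refine ⟨?_, hPD⟩
  rw [← hPD, IsSqrtDominatingRKHS, IsSqrtDominatingPD, rkhsFunctions_subset_iff hk hkt]
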